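/- Call a non-negative Borel measure $\mu$ on $\mathbb{R}$ admissible if $s_k(\mu) := \int x^k \, d\mu$ is finite (with $x^k$ $\mu$-integrable) for every integer $k \ge 0$. For a closed set $K \subset \mathbb{R}$, let $\mathcal{M}(K)$ be the set of all moment sequences $(s_0(\mu), s_1(\mu), \dots)$, and, for $n \ge 0$, let $\mathcal{M}_n(K)$ be the set of all truncated moment sequences $(s_0(\mu), \dots, s_n(\mu))$, where $\mu$ runs over the admissible measures supported on $K$. A function $F : \mathbb{R} \to \mathbb{R}$ acts on finite and infinite real sequences entrywise, $F[(s_k)_k] := (F(s_k))_k$. An absolutely monotonic entire function is an entire function whose Taylor coefficients at every point of $(0,\infty)$ are non-negative real numbers. **Theorem 6.3.** Let $F : \mathbb{R} \to \mathbb{R}$ and $u_0 \in (0,1)$. The following are equivalent. 1. $F[-]$ maps $\mathcal{M}(\{-1,-u_0\})$ into $\mathcal{M}([0,\infty))$, and maps $\mathcal{M}_4(\{-1,0\}) \cup \bigcup_{u \in (0,1)} \mathcal{M}_4(\{-u\})$ into $\mathcal{M}_4([0,\infty))$. 2. $F[-]$ maps $\mathcal{M}([-1,0])$ into $\mathcal{M}([0,1])$.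 3. There exists an absolutely monotonic entire function $\widetilde{F}$ such that $F(x) = \widetilde{F}(x)$ for all $x > 0$ and $F(x) = \widetilde{F}(-x)$ for all $x < 0$; moreover, the limit $\lim_{\epsilon \to 0,\ \epsilon \neq 0} F(\epsilon)$ exists and $0 \le F(0) \le \lim_{\epsilon \to 0,\ \epsilon \neq 0} F(\epsilon)$. -/

import Mathlib

open MeasureTheory Filter Topology

/-- An admissible measure carried by `K`: a (non-negative Borel) measure on the real line with
finite moments of all orders (in particular of finite mass), giving no mass to the complement
of `K`. For closed `K` this says that the support of `μ` is contained in `K`. -/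
structure IsAdmissibleOn (K : Set ℝ) (μ : Measure ℝ) : Prop where
  integrable_pow : ∀ k : ℕ, Integrable (fun x : ℝ => x ^ k) μ
  compl_null : μ Kᶜ = 0

/-- The `k`-th power moment `s_k(μ)`. -/
noncomputable def powerMoment (μ : Measure ℝ) (k : ℕ) : ℝ := ∫ x, x ^ k ∂μ

/-- The set `𝓜(K)` of moment sequences `(s_0(μ), s_1(μ), …)` of admissible measures on `K`. -/
def momentSeqs (K : Set ℝ) : Set (ℕ → ℝ) :=
  {s | ∃ μ : Measure ℝ, IsAdmissibleOn K μ ∧ ∀ k, s k = powerMoment μ k}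

/-- The set `𝓜_n(K)` of truncated moment sequences `(s_0(μ), …, s_n(μ))` of admissible measures
on `K`. -/
def truncMomentSeqs (n : ℕ) (K : Set ℝ) : Set (Fin (n + 1) → ℝ) :=
  {s | ∃ μ : Measure ℝ, IsAdmissibleOn K μ ∧ ∀ k : Fin (n + 1), s k = powerMoment μ k}

/-- The entrywise action `F[-]` of a function on finite or infinite sequences. -/
def entrywise {ι : Type*} (F : ℝ → ℝ) (s : ι → ℝ) : ι → ℝ := fun i => F (s i)

/-- An absolutely monotonic entire function: an entire function of a complex variable all of whose
derivatives (equivalently, Taylor coefficients) at every point of `(0, ∞)` are non-negative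
real numbers. -/
structure IsAbsMonotonicEntire (G : ℂ → ℂ) : Prop where
  entire : Differentiable ℂ G
  deriv_nonneg : ∀ x : ℝ, 0 < x → ∀ n : ℕ,
    0 ≤ (iteratedDeriv n G (x : ℂ)).re ∧ (iteratedDeriv n G (x : ℂ)).im = 0

/-! The second differences of `F[s]`, for `s` the moments of `x δ₋₁ + (y - x) δ₀` with `0 ≤ x ≤ y`,
show that `F` is even and that it is non-negative and monotone on `[0, ∞)`. Reflecting the measures
`a δ₋₁ + b δ₋ᵤ` to the half-line, one gets the positivity of the Hankel forms
`∑ cᵢ cⱼ F (a + b u ^ (i + j))`. For smooth `F`, expanding in `b → 0⁺` with a polynomial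
`∑ cᵢ X ^ i` that vanishes at `1, u, …, u ^ (n - 1)` isolates the `n`-th derivative and gives
`F⁽ⁿ⁾(a) ≥ 0`. A monotone `F` is squeezed between its translates by one-sided mollifications that
inherit the positivity; by Bernstein these are power series with non-negative coefficients, and a
compactness argument on the coefficients passes to the limit.

Conversely, multiplicative convolution makes the moment sequences on a submonoid of `[0, ∞)` closed
under entrywise products, hence under power series with non-negative coefficients. The value `F 0`
only enters for measures carried by `{0}`, whose image is carried by `{0, 1}`.
-/

open scoped ComplexOrder ContDiff Convolution Nat Pointwise

section EntirePowerSeries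

variable {𝕜 : Type*} [RCLike 𝕜] {a : ℕ → 𝕜} {G : 𝕜 → 𝕜}

theorem hasFPowerSeriesOnBall_ofScalars_of_hasSum
    (hG : ∀ z, HasSum (fun n => a n * z ^ n) (G z)) :
    HasFPowerSeriesOnBall G (FormalMultilinearSeries.ofScalars 𝕜 a) 0 ⊤ where
  r_le := by
    refine (ENNReal.eq_top_of_forall_nnreal_le fun r => ?_).ge
    refine FormalMultilinearSeries.le_radius_of_tendsto (l := 0) _ ?_
    simpa [FormalMultilinearSeries.ofScalars_norm] using
      (hG (r : ℝ)).summable.tendsto_atTop_zero.norm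
  r_pos := ENNReal.zero_lt_top
  hasSum := fun {y} _ => by
    simpa [FormalMultilinearSeries.ofScalars_apply_eq', mul_comm] using hG y

theorem differentiable_of_hasSum_pow (hG : ∀ z, HasSum (fun n => a n * z ^ n) (G z)) :
    Differentiable 𝕜 G := fun z =>
  ((hasFPowerSeriesOnBall_ofScalars_of_hasSum hG).analyticAt_of_mem (by simp)).differentiableAt

theorem iteratedDeriv_zero_of_hasSum_pow (hG : ∀ z, HasSum (fun n => a n * z ^ n) (G z)) (n : ℕ) :
    iteratedDeriv n G 0 = n ! * a n := by
  have h := (hasFPowerSeriesOnBall_ofScalars_of_hasSum hG).factorial_smul 1 n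
  simpa [iteratedDeriv_eq_iteratedFDeriv, FormalMultilinearSeries.ofScalars_apply_eq'] using h.symm

theorem summable_mul_pow_of_nonneg {a : ℕ → ℝ} (ha : ∀ n, 0 ≤ a n)
    (hs : ∀ x : ℝ, 0 < x → Summable fun n => a n * x ^ n) (z : 𝕜) :
    Summable fun n => (a n : 𝕜) * z ^ n := by
  refine Summable.of_norm_bounded (hs (‖z‖ + 1) (by positivity)) fun n => ?_
  have := ha n
  rw [norm_mul, norm_pow, RCLike.norm_of_nonneg this]
  gcongr
  linarith

end EntirePowerSeries

theorem isAbsMonotonicEntire_iff_iteratedDeriv_nonneg {G : ℂ → ℂ} :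
    IsAbsMonotonicEntire G ↔
      Differentiable ℂ G ∧ ∀ x : ℝ, 0 < x → ∀ n, 0 ≤ iteratedDeriv n G (x : ℂ) := by
  simp only [Complex.nonneg_iff, eq_comm (a := (0 : ℝ))]
  exact ⟨fun h => ⟨h.entire, h.deriv_nonneg⟩, fun h => ⟨h.1, h.2⟩⟩

theorem isAbsMonotonicEntire_iff_iteratedDeriv_zero_nonneg {G : ℂ → ℂ} :
    IsAbsMonotonicEntire G ↔ Differentiable ℂ G ∧ ∀ n, 0 ≤ iteratedDeriv n G 0 := by
  rw [isAbsMonotonicEntire_iff_iteratedDeriv_nonneg]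
  refine and_congr_right fun hG => ?_
  have hdiff (n : ℕ) : Differentiable ℂ (iteratedDeriv n G) :=
    (hG.contDiff (n := ω)).differentiable_iteratedDeriv n (by simp)
  constructor
  · intro h n
    have hlim : Tendsto (fun x : ℝ => iteratedDeriv n G x) (𝓝[>] 0) (𝓝 (iteratedDeriv n G 0)) := by
      have := ((hdiff n).continuous.comp Complex.continuous_ofReal).tendsto 0
      simpa [Function.comp_def] using this.mono_left nhdsWithin_le_nhds
    exact ge_of_tendsto hlim (eventually_mem_nhdsWithin.mono fun x hx => h x hx n)
  · intro h x hx n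
    refine (hdiff n).nonneg_of_iteratedDeriv_nonneg (c := 0) (fun m => ?_) (by exact_mod_cast hx.le)
    have hcomp : iteratedDeriv m (iteratedDeriv n G) = iteratedDeriv (m + n) G := by
      simp only [iteratedDeriv_eq_iterate, Function.iterate_add_apply]
    exact hcomp ▸ h (m + n)

theorem isAbsMonotonicEntire_iff_exists_hasSum {G : ℂ → ℂ} :
    IsAbsMonotonicEntire G ↔ ∃ a : ℕ → ℝ, (∀ n, 0 ≤ a n) ∧
      ∀ z : ℂ, HasSum (fun n => (a n : ℂ) * z ^ n) (G z) := by
  rw [isAbsMonotonicEntire_iff_iteratedDeriv_zero_nonneg]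
  constructor
  · rintro ⟨hG, h⟩
    refine ⟨fun n => (n ! : ℝ)⁻¹ * (iteratedDeriv n G 0).re, fun n => ?_, fun z => ?_⟩
    · exact mul_nonneg (by positivity) (Complex.nonneg_iff.1 (h n)).1
    · convert! Complex.hasSum_taylorSeries_of_entire hG 0 z using 2 with n
      simp only [Complex.ofReal_mul, ← Complex.eq_re_of_ofReal_le (h n)]
      push_cast
      simp only [sub_zero, smul_eq_mul]
      ring
  · rintro ⟨a, ha, hG⟩
    refine ⟨differentiable_of_hasSum_pow hG, fun n => ?_⟩
    rw [iteratedDeriv_zero_of_hasSum_pow hG]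
    exact_mod_cast mul_nonneg n.factorial.cast_nonneg (ha n)

section Bernstein

variable {f : ℝ → ℝ} {s t : Set ℝ} {x y : ℝ}

theorem iteratedDerivWithin_eq_of_subset {n : ℕ} (ht : UniqueDiffOn ℝ t) (hs : UniqueDiffOn ℝ s)
    (hts : t ⊆ s) (hf : ContDiffOn ℝ n f s) (hx : x ∈ t) :
    iteratedDerivWithin n f t x = iteratedDerivWithin n f s x := by
  simp only [iteratedDerivWithin, iteratedFDerivWithin_subset hts ht hs hf hx]

theorem taylorWithinEval_eq_of_subset {n : ℕ} (ht : UniqueDiffOn ℝ t) (hs : UniqueDiffOn ℝ s)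
    (hts : t ⊆ s) (hf : ContDiffOn ℝ n f s) (hx : x ∈ t) :
    taylorWithinEval f n t x y = taylorWithinEval f n s x y := by
  simp only [taylor_within_apply]
  refine Finset.sum_congr rfl fun k hk => ?_
  have hkn : k ≤ n := Finset.mem_range_succ_iff.1 hk
  rw [iteratedDerivWithin_eq_of_subset ht hs hts (hf.of_le (by exact_mod_cast hkn)) hx]

theorem exists_lagrange_remainder_within {n : ℕ} (hs : UniqueDiffOn ℝ s)
    (hf : ContDiffOn ℝ (n + 1 : ℕ) f s) (hxy : x < y) (hsub : Set.Icc x y ⊆ s) :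
    ∃ ξ ∈ Set.Ioo x y, f y = taylorWithinEval f n s x y +
      iteratedDerivWithin (n + 1) f s ξ * (y - x) ^ (n + 1) / (n + 1)! := by
  have hu : UniqueDiffOn ℝ (Set.Icc x y) := uniqueDiffOn_Icc hxy
  have hfn : ContDiffOn ℝ n f s := hf.of_le (by exact_mod_cast n.le_succ)
  have hdiff : DifferentiableOn ℝ (iteratedDerivWithin n f (Set.Icc x y)) (Set.Ioo x y) :=
    ((hf.mono hsub).differentiableOn_iteratedDerivWithin
      (by exact_mod_cast n.lt_succ_self) hu).mono Set.Ioo_subset_Icc_self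
  have hlagrange := taylor_mean_remainder_lagrange (f := f) (n := n) hxy.ne
  rw [Set.uIcc_of_lt hxy, Set.uIoo_of_lt hxy] at hlagrange
  obtain ⟨ξ, hξ, h⟩ := hlagrange (hfn.mono hsub) hdiff
  rw [taylorWithinEval_eq_of_subset hu hs hsub hfn (Set.left_mem_Icc.2 hxy.le),
    iteratedDerivWithin_eq_of_subset hu hs hsub hf (Set.Ioo_subset_Icc_self hξ)] at h
  exact ⟨ξ, hξ, (add_eq_of_eq_sub' h.symm).symm⟩

theorem taylorWithinEval_le (hf : AbsolutelyMonotoneOn f s) (hs : UniqueDiffOn ℝ s)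
    (hxy : x < y) (hsub : Set.Icc x y ⊆ s) (n : ℕ) : taylorWithinEval f n s x y ≤ f y := by
  obtain ⟨ξ, hξ, h⟩ := exists_lagrange_remainder_within (n := n) hs
    (hf.contDiffOn.of_le (by exact_mod_cast le_top)) hxy hsub
  rw [h, le_add_iff_nonneg_right]
  have := hf.iteratedDerivWithin_nonneg hs (n + 1) (hsub (Set.Ioo_subset_Icc_self hξ))
  have := (sub_pos.2 hxy).le
  positivity

theorem iteratedDerivWithin_mul_pow_div_factorial_le (hf : AbsolutelyMonotoneOn f s)
    (hs : UniqueDiffOn ℝ s) (hxy : x < y) (hsub : Set.Icc x y ⊆ s) (n : ℕ) :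
    iteratedDerivWithin n f s x * (y - x) ^ n / n ! ≤ f y := by
  have hx : x ∈ s := hsub (Set.left_mem_Icc.2 hxy.le)
  refine le_trans ?_ (taylorWithinEval_le hf hs hxy hsub n)
  rw [taylor_within_apply]
  refine le_trans (by rw [smul_eq_mul]; ring_nf; rfl) (Finset.single_le_sum
    (f := fun k => ((k ! : ℝ)⁻¹ * (y - x) ^ k) • iteratedDerivWithin k f s x) (fun k _ => ?_)
    (Finset.self_mem_range_succ n))
  exact mul_nonneg (mul_nonneg (by positivity) (pow_nonneg (sub_nonneg.2 hxy.le) k))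
    (hf.iteratedDerivWithin_nonneg hs k hx)

theorem monotoneOn_iteratedDerivWithin (hf : AbsolutelyMonotoneOn f s) (hs : UniqueDiffOn ℝ s)
    (hconv : Convex ℝ s) (n : ℕ) : MonotoneOn (iteratedDerivWithin n f s) s := by
  have hdiff : DifferentiableOn ℝ (iteratedDerivWithin n f s) s :=
    hf.contDiffOn.differentiableOn_iteratedDerivWithin (by exact_mod_cast WithTop.coe_lt_top _) hs
  refine monotoneOn_of_deriv_nonneg hconv hdiff.continuousOn (hdiff.mono interior_subset)
    fun x hx => ?_
  rw [← derivWithin_of_mem_nhds (mem_interior_iff_mem_nhds.1 hx), ← iteratedDerivWithin_succ]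
  exact hf.iteratedDerivWithin_nonneg hs (n + 1) (interior_subset hx)

theorem sub_taylorWithinEval_le {a : ℝ} (hf : AbsolutelyMonotoneOn f (Set.Ici a)) (hx : a < x)
    (n : ℕ) :
    f x - taylorWithinEval f n (Set.Ici a) a x ≤ f (x + 2 * (x - a)) * (1 / 2) ^ (n + 1) := by
  set r := x - a
  have hr0 : 0 < r := sub_pos.2 hx
  have hu : UniqueDiffOn ℝ (Set.Ici a) := uniqueDiffOn_Ici a
  obtain ⟨ξ, hξ, h⟩ := exists_lagrange_remainder_within hu
    (hf.contDiffOn.of_le (by exact_mod_cast le_top)) hx Set.Icc_subset_Ici_self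
  rw [h, add_sub_cancel_left]
  calc iteratedDerivWithin (n + 1) f (Set.Ici a) ξ * r ^ (n + 1) / (n + 1)!
      ≤ iteratedDerivWithin (n + 1) f (Set.Ici a) x * r ^ (n + 1) / (n + 1)! := by
        gcongr
        exact monotoneOn_iteratedDerivWithin hf hu (convex_Ici a) _ hξ.1.le hx.le hξ.2.le
    _ = iteratedDerivWithin (n + 1) f (Set.Ici a) x * (x + 2 * r - x) ^ (n + 1) / (n + 1)! *
          (1 / 2) ^ (n + 1) := by
        rw [add_sub_cancel_left, mul_pow, one_div, inv_pow]
        field_simp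
    _ ≤ f (x + 2 * r) * (1 / 2) ^ (n + 1) := by
        gcongr
        exact iteratedDerivWithin_mul_pow_div_factorial_le hf hu (by linarith)
          (Set.Icc_subset_Ici_iff (by linarith) |>.2 hx.le) _

theorem hasSum_taylor_of_absolutelyMonotoneOn {a : ℝ} (hf : AbsolutelyMonotoneOn f (Set.Ici a))
    (hx : a < x) :
    HasSum (fun n => iteratedDerivWithin n f (Set.Ici a) a / n ! * (x - a) ^ n) (f x) := by
  have hu : UniqueDiffOn ℝ (Set.Ici a) := uniqueDiffOn_Ici a
  have hpartial (n : ℕ) : taylorWithinEval f n (Set.Ici a) a x =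
      ∑ k ∈ Finset.range (n + 1), iteratedDerivWithin k f (Set.Ici a) a / k ! * (x - a) ^ k := by
    rw [taylor_within_apply]
    exact Finset.sum_congr rfl fun k _ => by rw [smul_eq_mul]; ring
  have hlower : Tendsto (fun n : ℕ => f x - f (x + 2 * (x - a)) * (1 / 2) ^ (n + 1))
      atTop (𝓝 (f x)) := by
    have hgeom : Tendsto (fun n : ℕ => (1 / 2 : ℝ) ^ (n + 1)) atTop (𝓝 0) :=
      (tendsto_pow_atTop_nhds_zero_of_lt_one (by norm_num) (by norm_num)).comp
        (tendsto_add_atTop_nat 1)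
    simpa using (hgeom.const_mul (f (x + 2 * (x - a)))).const_sub (f x)
  rw [hasSum_iff_tendsto_nat_of_nonneg fun n => mul_nonneg
    (div_nonneg (hf.iteratedDerivWithin_nonneg hu n Set.self_mem_Ici) (by positivity))
    (pow_nonneg (sub_nonneg.2 hx.le) n), ← tendsto_add_atTop_iff_nat 1]
  simp only [← hpartial]
  exact tendsto_of_tendsto_of_tendsto_of_le_of_le hlower tendsto_const_nhds
    (fun n => sub_le_comm.1 (sub_taylorWithinEval_le hf hx n))
    fun n => taylorWithinEval_le hf hu hx Set.Icc_subset_Ici_self n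

end Bernstein

section PowerSeriesLimits

theorem continuous_tsum_mul_pow {a : ℕ → ℝ} (ha : ∀ n, 0 ≤ a n)
    (hs : ∀ x : ℝ, 0 < x → Summable fun n => a n * x ^ n) :
    Continuous fun x : ℝ => ∑' n, a n * x ^ n :=
  (differentiable_of_hasSum_pow fun z => by
    simpa using (summable_mul_pow_of_nonneg ha hs z).hasSum).continuous

variable {c : ℕ → ℕ → ℝ} {f : ℕ → ℝ → ℝ}

theorem mul_pow_le_geometric_of_hasSum {c : ℕ → ℝ} (hc : ∀ n, 0 ≤ c n) {x y : ℝ} (hx : 0 ≤ x)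
    (hy : HasSum (fun n => c n * (2 * x) ^ n) y) (n : ℕ) : c n * x ^ n ≤ y * (1 / 2) ^ n := by
  calc c n * x ^ n = c n * (2 * x) ^ n * (1 / 2) ^ n := by
        rw [mul_assoc, ← mul_pow]
        ring
    _ ≤ y * (1 / 2) ^ n := by
        gcongr
        exact le_hasSum hy n fun k _ => mul_nonneg (hc k) (by positivity)

theorem exists_subseq_tendsto_of_hasSum (hc : ∀ m n, 0 ≤ c m n)
    (hf : ∀ m, ∀ x : ℝ, 0 < x → HasSum (fun n => c m n * x ^ n) (f m x))
    (hbdd : ∀ x, 0 < x → BddAbove (Set.range fun m => f m x)) :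
    ∃ (κ : ℕ → ℕ) (a : ℕ → ℝ), StrictMono κ ∧ (∀ n, 0 ≤ a n) ∧
      ∀ x : ℝ, 0 < x → (Summable fun n => a n * x ^ n) ∧
        Tendsto (fun m => f (κ m) x) atTop (𝓝 (∑' n, a n * x ^ n)) := by
  choose! B hB using hbdd
  have hfB (x : ℝ) (hx : 0 < x) (m : ℕ) : f m x ≤ B x := hB x hx ⟨m, rfl⟩
  have hterm (x : ℝ) (hx : 0 < x) (m n : ℕ) : c m n * x ^ n ≤ B (2 * x) * (1 / 2) ^ n :=
    (mul_pow_le_geometric_of_hasSum (hc m) hx.le (hf m _ (by positivity)) n).trans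
      (by gcongr; exact hfB _ (by positivity) m)
  have hgeom (x : ℝ) : Summable fun n : ℕ => B (2 * x) * (1 / 2 : ℝ) ^ n :=
    summable_geometric_two.mul_left _
  obtain ⟨a, ha, κ, hκ, hlim⟩ := (isCompact_univ_pi fun n : ℕ =>
    isCompact_Icc (a := (0 : ℝ)) (b := B (2 * 1) * (1 / 2) ^ n)).tendsto_subseq (x := c)
    fun m n _ => ⟨hc m n, by simpa using hterm 1 one_pos m n⟩
  rw [tendsto_pi_nhds] at hlim
  have ha0 (n : ℕ) : 0 ≤ a n := (ha n (Set.mem_univ n)).1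
  refine ⟨κ, a, hκ, ha0, fun x hx => ⟨?_, ?_⟩⟩
  · exact Summable.of_nonneg_of_le (fun n => mul_nonneg (ha0 n) (by positivity))
      (fun n => le_of_tendsto ((hlim n).mul_const _) (Eventually.of_forall fun m => hterm x hx _ n))
      (hgeom x)
  · refine (tendsto_tsum_of_dominated_convergence (𝓕 := atTop)
      (f := fun m n => c (κ m) n * x ^ n) (hgeom x) (fun n => (hlim n).mul_const _)
      (Eventually.of_forall fun m n => ?_)).congr fun m => (hf (κ m) x hx).tsum_eq
    rw [Real.norm_of_nonneg (mul_nonneg (hc _ _) (by positivity))]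
    exact hterm x hx _ n

theorem exists_hasSum_of_sandwich {H : ℝ → ℝ} (hH : MonotoneOn H (Set.Ioi 0))
    (hc : ∀ m n, 0 ≤ c m n)
    (hf : ∀ m, ∀ x : ℝ, 0 < x → HasSum (fun n => c m n * x ^ n) (f m x)) {ε : ℕ → ℝ}
    (hε : Tendsto ε atTop (𝓝 0)) (hε0 : ∀ m, 0 ≤ ε m) (hlow : ∀ m x, 0 < x → H x ≤ f m x)
    (hup : ∀ m x, 0 < x → f m x ≤ H (x + ε m)) :
    ∃ a : ℕ → ℝ, (∀ n, 0 ≤ a n) ∧ ∀ x : ℝ, 0 < x → HasSum (fun n => a n * x ^ n) (H x) := by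
  obtain ⟨E, hE⟩ := hε.bddAbove_range
  have hbdd (x : ℝ) (hx : 0 < x) : BddAbove (Set.range fun m => f m x) := by
    refine ⟨H (x + E), Set.forall_mem_range.2 fun m => (hup m x hx).trans ?_⟩
    have hm : ε m ≤ E := hE ⟨m, rfl⟩
    exact hH (add_pos_of_pos_of_nonneg hx (hε0 m))
      (add_pos_of_pos_of_nonneg hx ((hε0 m).trans hm)) (by gcongr)
  obtain ⟨κ, a, hκ, ha, hlim⟩ := exists_subseq_tendsto_of_hasSum hc hf hbdd
  have hs : ∀ x : ℝ, 0 < x → Summable fun n => a n * x ^ n := fun x hx => (hlim x hx).1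
  refine ⟨a, ha, fun x hx => (hs x hx).hasSum_iff.2 (le_antisymm ?_ ?_)⟩
  · have hleft (y : ℝ) (hy : y ∈ Set.Ioo 0 x) : ∑' n, a n * y ^ n ≤ H x := by
      refine le_of_tendsto (hlim y hy.1).2 ?_
      filter_upwards [(hε.comp hκ.tendsto_atTop).eventually_lt_const (sub_pos.2 hy.2)] with m hm
      exact (hup _ y hy.1).trans (hH (add_pos_of_pos_of_nonneg hy.1 (hε0 _)) hx
        (lt_sub_iff_add_lt'.1 hm).le)
    exact le_of_tendsto
      (((continuous_tsum_mul_pow ha hs).tendsto x).mono_left (nhdsWithin_le_nhds (s := Set.Iio x)))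
      (Filter.mem_of_superset (Ioo_mem_nhdsLT hx) hleft)
  · exact ge_of_tendsto (hlim x hx).2 (Eventually.of_forall fun m => hlow _ x hx)

end PowerSeriesLimits

section Mollification

theorem le_sum_normed_convolution {E ι : Type*} [NormedAddCommGroup E] [NormedSpace ℝ E]
    [FiniteDimensional ℝ E] [HasContDiffBump E] [MeasurableSpace E] [BorelSpace E] {μ : Measure E}
    [μ.IsAddHaarMeasure] {c : E} (ρ : ContDiffBump c) {H : E → ℝ} (hH : LocallyIntegrable H μ)
    (s : Finset ι) (w : ι → ℝ) (y : ι → E) {v : ℝ}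
    (h : ∀ t ∈ Metric.ball c ρ.rOut, v ≤ ∑ i ∈ s, w i * H (y i - t)) :
    v ≤ ∑ i ∈ s, w i * (ρ.normed μ ⋆[ContinuousLinearMap.lsmul ℝ ℝ, μ] H) (y i) := by
  have hint (i : ι) : Integrable (fun t => ρ.normed μ t * H (y i - t)) μ :=
    HasCompactSupport.convolutionExists_left (ContinuousLinearMap.lsmul ℝ ℝ)
      ρ.hasCompactSupport_normed ρ.continuous_normed hH (y i)
  calc v = ∫ t, ρ.normed μ t * v ∂μ := by
        rw [integral_mul_const, ρ.integral_normed, one_mul]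
    _ ≤ ∫ t, ∑ i ∈ s, w i * (ρ.normed μ t * H (y i - t)) ∂μ := by
        refine integral_mono (ρ.integrable_normed.mul_const v)
          (integrable_finsetSum s fun i _ => (hint i).const_mul _) fun t => ?_
        by_cases ht : ρ.normed μ t = 0
        · simp [ht]
        · have hball : t ∈ Metric.ball c ρ.rOut := ρ.support_normed_eq (μ := μ) ▸ ht
          simpa only [Finset.mul_sum, mul_left_comm] using
            mul_le_mul_of_nonneg_left (h t hball) (ρ.nonneg_normed t)
    _ = ∑ i ∈ s, w i * (ρ.normed μ ⋆[ContinuousLinearMap.lsmul ℝ ℝ, μ] H) (y i) := by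
        rw [integral_finsetSum s fun i _ => (hint i).const_mul _]
        simp only [integral_const_mul]
        rfl

theorem exists_contDiff_approx_of_monotone {H : ℝ → ℝ} (hH : Monotone H) {ε : ℝ} (hε : 0 < ε) :
    ∃ f : ℝ → ℝ, ContDiff ℝ ∞ f ∧ (∀ x, H x ≤ f x) ∧ (∀ x, f x ≤ H (x + ε)) ∧
      ∀ (s : Finset ℕ) (w y : ℕ → ℝ), (∀ t, 0 ≤ t → 0 ≤ ∑ i ∈ s, w i * H (y i + t)) →
        0 ≤ ∑ i ∈ s, w i * f (y i) := by
  -- Supported on negative `t`, the mollifier averages the translates `H (· - t)` to the right.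
  let ρ : ContDiffBump (-(ε / 2)) := ⟨ε / 4, ε / 2, by linarith, by linarith⟩
  have hρ (t : ℝ) (ht : t ∈ Metric.ball (-(ε / 2)) ρ.rOut) : -ε < t ∧ t < 0 := by
    have h : |t + ε / 2| < ε / 2 := by simpa [Real.dist_eq] using ht
    constructor <;> linarith [(abs_lt.1 h).1, (abs_lt.1 h).2]
  have key := fun s w y v => le_sum_normed_convolution ρ (μ := volume) hH.locallyIntegrable
    (ι := ℕ) s w y (v := v)
  refine ⟨ρ.normed volume ⋆[ContinuousLinearMap.lsmul ℝ ℝ, volume] H,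
    ρ.hasCompactSupport_normed.contDiff_convolution_left _ ρ.contDiff_normed hH.locallyIntegrable,
    fun x => ?_, fun x => ?_, fun s w y h => key s w y 0 fun t ht => ?_⟩
  · simpa using key {0} (fun _ => 1) (fun _ => x) (H x) fun t ht => by
      simpa using hH (show x ≤ x - t by linarith [hρ t ht])
  · simpa using key {0} (fun _ => -1) (fun _ => x) (-H (x + ε)) fun t ht => by
      simpa using hH (show x - t ≤ x + ε by linarith [hρ t ht])
  · simpa only [sub_eq_add_neg] using h (-t) (by linarith [hρ t ht])

end Mollification

section GeometricProgressions

open Polynomial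

/-- The Riesz functional of a real sequence `s`: the linear functional on polynomials sending
`X ^ n` to `s n`. -/
noncomputable def rieszFunctional (s : ℕ → ℝ) : ℝ[X] →ₗ[ℝ] ℝ :=
  Polynomial.lsum fun n => LinearMap.mulRight ℝ (s n)

theorem rieszFunctional_apply (s : ℕ → ℝ) (p : ℝ[X]) :
    rieszFunctional s p = ∑ n ∈ p.support, p.coeff n * s n := by
  simp [rieszFunctional, Polynomial.sum_def]

@[simp]
theorem rieszFunctional_X_pow (s : ℕ → ℝ) (n : ℕ) : rieszFunctional s (X ^ n) = s n := by
  simp [rieszFunctional, ← monomial_one_right_eq_X_pow]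

theorem iteratedDeriv_nonneg_of_eventually_nonneg {g : ℝ → ℝ} {a : ℝ} {n : ℕ}
    (hg : ContDiff ℝ n g) (hpos : ∀ᶠ x in 𝓝[>] a, 0 ≤ g x)
    (hzero : ∀ m < n, iteratedDeriv m g a = 0) : 0 ≤ iteratedDeriv n g a := by
  have htaylor (x : ℝ) :
      taylorWithinEval g n Set.univ a x = (x - a) ^ n * (iteratedDeriv n g a / n !) := by
    rw [taylor_within_apply, Finset.sum_range_succ, Finset.sum_eq_zero fun k hk => by
      rw [iteratedDerivWithin_univ, hzero k (Finset.mem_range.1 hk), smul_zero]]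
    rw [iteratedDerivWithin_univ, smul_eq_mul]
    ring
  have hlim : Tendsto (fun x => g x / (x - a) ^ n) (𝓝[>] a) (𝓝 (iteratedDeriv n g a / n !)) := by
    have h := (Real.taylor_tendsto convex_univ (Set.mem_univ a) hg.contDiffOn).mono_left
      (nhdsWithin_mono a (Set.subset_univ (Set.Ioi a)))
    refine tendsto_sub_nhds_zero_iff.1 (h.congr' (eventually_mem_nhdsWithin.mono fun x hx => ?_))
    have : x - a ≠ 0 := (sub_pos.2 hx).ne'
    rw [htaylor]
    field_simp
  have hquot : 0 ≤ iteratedDeriv n g a / n ! := by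
    refine ge_of_tendsto hlim ?_
    filter_upwards [hpos, eventually_mem_nhdsWithin] with x hx hxa
    exact div_nonneg hx (pow_nonneg (sub_pos.2 hxa).le n)
  exact nonneg_of_mul_nonneg_left (by rwa [div_eq_mul_inv] at hquot) (by positivity)

theorem contDiff_rieszFunctional_geometric {k : WithTop ℕ∞} {f : ℝ → ℝ} (hf : ContDiff ℝ k f)
    (a u : ℝ) (p : ℝ[X]) :
    ContDiff ℝ k fun b => rieszFunctional (fun j => f (a + b * u ^ j)) p := by
  simp only [rieszFunctional_apply]
  fun_prop

theorem iteratedDeriv_rieszFunctional_geometric {f : ℝ → ℝ} {m : ℕ} (hf : ContDiff ℝ m f)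
    (a u : ℝ) (p : ℝ[X]) :
    iteratedDeriv m (fun b => rieszFunctional (fun j => f (a + b * u ^ j)) p) 0 =
      p.eval (u ^ m) * iteratedDeriv m f a := by
  have hterm (j : ℕ) : iteratedDeriv m (fun b => f (a + b * u ^ j)) 0 =
      (u ^ m) ^ j * iteratedDeriv m f a := by
    have h := congrFun (iteratedDeriv_comp_const_mul (hf.comp (contDiff_const.add contDiff_id))
      (u ^ j) (f := fun z => f (a + z))) 0
    simp only [mul_comm (u ^ j)] at h
    rw [h, iteratedDeriv_comp_const_add]
    simp only [zero_mul, add_zero]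
    ring
  simp only [rieszFunctional_apply]
  rw [iteratedDeriv_fun_sum fun j _ => by fun_prop, eval_eq_sum, Polynomial.sum_def,
    Finset.sum_mul]
  refine Finset.sum_congr rfl fun j _ => ?_
  rw [iteratedDeriv_const_mul_field, hterm, mul_assoc]

theorem iteratedDeriv_nonneg_of_rieszFunctional_geometric {f : ℝ → ℝ} {n : ℕ}
    (hf : ContDiff ℝ n f) {u : ℝ} (hu0 : 0 < u) (hu1 : u ≠ 1) {a : ℝ}
    (hpos : ∀ b, 0 < b → ∀ q : ℝ[X],
      0 ≤ rieszFunctional (fun j => f (a + b * u ^ j)) (q ^ 2)) :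
    0 ≤ iteratedDeriv n f a := by
  -- The square of this polynomial kills the derivatives of order `< n` at `b = 0`.
  let q : ℝ[X] := Lagrange.nodal (Finset.range n) (u ^ ·)
  have hq_ne : q.eval (u ^ n) ≠ 0 := Lagrange.eval_nodal_not_at_node fun i hi h =>
    (Finset.mem_range.1 hi).ne' (pow_right_injective₀ hu0 hu1 h)
  have hnonneg := iteratedDeriv_nonneg_of_eventually_nonneg (a := 0)
    (contDiff_rieszFunctional_geometric hf a u (q ^ 2))
    (eventually_mem_nhdsWithin.mono fun b hb => hpos b hb q) fun m hm => by
      have hq_zero : q.eval (u ^ m) = 0 := Lagrange.eval_nodal_at_node (Finset.mem_range.2 hm)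
      rw [iteratedDeriv_rieszFunctional_geometric (hf.of_le (by exact_mod_cast hm.le)), eval_pow,
        hq_zero, zero_pow two_ne_zero, zero_mul]
  rw [iteratedDeriv_rieszFunctional_geometric hf, eval_pow] at hnonneg
  exact nonneg_of_mul_nonneg_right hnonneg (by positivity)

theorem exists_hasSum_of_rieszFunctional_geometric {H : ℝ → ℝ} (hH : Monotone H) {u : ℝ}
    (hu0 : 0 < u) (hu1 : u ≠ 1)
    (hpos : ∀ a b, 0 ≤ a → 0 < b → ∀ q : ℝ[X],
      0 ≤ rieszFunctional (fun j => H (a + b * u ^ j)) (q ^ 2)) :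
    ∃ a : ℕ → ℝ, (∀ n, 0 ≤ a n) ∧ ∀ x : ℝ, 0 < x → HasSum (fun n => a n * x ^ n) (H x) := by
  choose f hf hlow hup hineq using fun m : ℕ =>
    exists_contDiff_approx_of_monotone hH (Nat.one_div_pos_of_nat (α := ℝ) (n := m))
  have habs (m : ℕ) : AbsolutelyMonotoneOn (f m) (Set.Ici 0) := by
    refine .of_contDiff (hf m) fun n x hx => iteratedDeriv_nonneg_of_rieszFunctional_geometric
      ((hf m).of_le (by exact_mod_cast le_top)) hu0 hu1 fun b hb q => ?_
    rw [rieszFunctional_apply]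
    refine hineq m _ _ (fun j => x + b * u ^ j) fun t ht => ?_
    simpa only [rieszFunctional_apply, add_right_comm x t] using
      hpos (x + t) b (add_nonneg hx ht) hb q
  refine exists_hasSum_of_sandwich (hH.monotoneOn _)
    (c := fun m n => iteratedDerivWithin n (f m) (Set.Ici 0) 0 / n !) (fun m n => ?_)
    (fun m x hx => ?_) tendsto_one_div_add_atTop_nhds_zero_nat
    (fun m => Nat.one_div_pos_of_nat.le) (fun m x _ => hlow m x) fun m x _ => hup m x
  · exact div_nonneg ((habs m).iteratedDerivWithin_nonneg (uniqueDiffOn_Ici 0) n Set.self_mem_Ici)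
      (by positivity)
  · simpa only [sub_zero] using hasSum_taylor_of_absolutelyMonotoneOn (habs m) hx

end GeometricProgressions

section MomentSequences

open Polynomial

variable {K K' : Set ℝ} {μ ν : Measure ℝ} {s : ℕ → ℝ}

theorem IsAdmissibleOn.ae_mem (hμ : IsAdmissibleOn K μ) : ∀ᵐ x ∂μ, x ∈ K :=
  ae_iff.2 hμ.compl_null

theorem IsAdmissibleOn.isFiniteMeasure (hμ : IsAdmissibleOn K μ) : IsFiniteMeasure μ := by
  simpa [integrable_const_iff, isFiniteMeasure_iff] using hμ.integrable_pow 0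

theorem IsAdmissibleOn.mono (hμ : IsAdmissibleOn K μ) (h : K ⊆ K') : IsAdmissibleOn K' μ :=
  ⟨hμ.integrable_pow, measure_mono_null (Set.compl_subset_compl.2 h) hμ.compl_null⟩

theorem momentSeqs_mono (h : K ⊆ K') : momentSeqs K ⊆ momentSeqs K' :=
  fun _ ⟨μ, hμ, hs⟩ => ⟨μ, hμ.mono h, hs⟩

theorem mem_truncMomentSeqs_iff {n : ℕ} {s : Fin (n + 1) → ℝ} :
    s ∈ truncMomentSeqs n K ↔ ∃ t ∈ momentSeqs K, ∀ k : Fin (n + 1), s k = t k :=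
  ⟨fun ⟨μ, hμ, hs⟩ => ⟨powerMoment μ, ⟨μ, hμ, fun _ => rfl⟩, hs⟩,
    fun ⟨_, ⟨μ, hμ, ht⟩, hs⟩ => ⟨μ, hμ, fun k => (hs k).trans (ht k)⟩⟩

theorem mapsTo_truncMomentSeqs {F : ℝ → ℝ}
    (h : Set.MapsTo (entrywise F) (momentSeqs K) (momentSeqs K')) (n : ℕ) :
    Set.MapsTo (entrywise F) (truncMomentSeqs n K) (truncMomentSeqs n K') := by
  intro s hs
  obtain ⟨t, ht, hst⟩ := mem_truncMomentSeqs_iff.1 hs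
  exact mem_truncMomentSeqs_iff.2 ⟨_, h ht, fun k => congrArg F (hst k)⟩

theorem pow_mem_momentSeqs {x : ℝ} (hx : x ∈ K) : (fun k => x ^ k) ∈ momentSeqs K :=
  ⟨Measure.dirac x, ⟨fun _ => integrable_dirac (by simp), by simp [hx]⟩,
    fun k => by simp [powerMoment]⟩

theorem add_mem_momentSeqs {t : ℕ → ℝ} (hs : s ∈ momentSeqs K) (ht : t ∈ momentSeqs K) :
    s + t ∈ momentSeqs K := by
  obtain ⟨μ, hμ, hs⟩ := hs
  obtain ⟨ν, hν, ht⟩ := ht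
  refine ⟨μ + ν, ⟨fun k => (hμ.integrable_pow k).add_measure (hν.integrable_pow k), ?_⟩,
    fun k => ?_⟩
  · simp [hμ.compl_null, hν.compl_null]
  · rw [Pi.add_apply, hs, ht]
    exact (integral_add_measure (hμ.integrable_pow k) (hν.integrable_pow k)).symm

theorem smul_mem_momentSeqs {c : ℝ} (hc : 0 ≤ c) (hs : s ∈ momentSeqs K) :
    c • s ∈ momentSeqs K := by
  obtain ⟨μ, hμ, hs⟩ := hs
  refine ⟨ENNReal.ofReal c • μ,
    ⟨fun k => (hμ.integrable_pow k).smul_measure ENNReal.ofReal_ne_top, ?_⟩, fun k => ?_⟩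
  · simp [hμ.compl_null]
  · rw [powerMoment, integral_smul_measure, ENNReal.toReal_ofReal hc, Pi.smul_apply, hs,
      powerMoment]

theorem two_point_mem_momentSeqs {a b x y : ℝ} (ha : 0 ≤ a) (hb : 0 ≤ b) :
    (fun k => a * x ^ k + b * y ^ k) ∈ momentSeqs {x, y} :=
  add_mem_momentSeqs (smul_mem_momentSeqs ha (pow_mem_momentSeqs (by simp)))
    (smul_mem_momentSeqs hb (pow_mem_momentSeqs (by simp)))

theorem hasSum_mem_momentSeqs (hK : K ⊆ Set.Ici 0) {s : ℕ → ℕ → ℝ} {t : ℕ → ℝ}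
    (hs : ∀ n, s n ∈ momentSeqs K) (ht : ∀ k, HasSum (fun n => s n k) (t k)) :
    t ∈ momentSeqs K := by
  choose μ hμ hs using hs
  have hint (k : ℕ) : Integrable (fun x : ℝ => x ^ k) (Measure.sum μ) := by
    refine integrable_sum_measure (fun n => (hμ n).integrable_pow k) ((ht k).summable.congr ?_)
    intro n
    rw [hs]
    refine integral_congr_ae ((hμ n).ae_mem.mono fun x hx => ?_)
    exact (Real.norm_of_nonneg (pow_nonneg (hK hx) k)).symm
  refine ⟨Measure.sum μ, ⟨hint, ?_⟩, fun k => ?_⟩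
  · simp [Measure.sum_apply_of_countable, (hμ _).compl_null]
  · have h := hasSum_integral_measure (hint k)
    exact (ht k).unique (by simpa only [hs, powerMoment] using h)

theorem mul_mem_momentSeqs {S : Subsemigroup ℝ} (hS : MeasurableSet (S : Set ℝ)) {t : ℕ → ℝ}
    (hs : s ∈ momentSeqs (S : Set ℝ)) (ht : t ∈ momentSeqs (S : Set ℝ)) :
    s * t ∈ momentSeqs (S : Set ℝ) := by
  obtain ⟨μ, hμ, hs⟩ := hs
  obtain ⟨ν, hν, ht⟩ := ht
  have := hμ.isFiniteMeasure
  have := hν.isFiniteMeasure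
  refine ⟨μ.mconv ν, ⟨fun k => ?_, ?_⟩, fun k => ?_⟩
  · rw [Measure.mconv, integrable_map_measure (by fun_prop) (by fun_prop)]
    simpa only [Function.comp_def, mul_pow] using
      (hμ.integrable_pow k).mul_prod (hν.integrable_pow k)
  · refine ae_iff.1 ((ae_map_iff (p := (· ∈ (S : Set ℝ))) (by fun_prop) hS).2 ?_)
    filter_upwards [Measure.quasiMeasurePreserving_fst.ae hμ.ae_mem,
      Measure.quasiMeasurePreserving_snd.ae hν.ae_mem] with p hp hq
    exact S.mul_mem hp hq
  · rw [Pi.mul_apply, hs, ht, powerMoment, powerMoment, powerMoment, Measure.mconv,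
      integral_map (by fun_prop) (by fun_prop)]
    simp only [mul_pow]
    exact (integral_prod_mul (fun x : ℝ => x ^ k) fun x : ℝ => x ^ k).symm

theorem pow_seq_mem_momentSeqs {S : Submonoid ℝ} (hS : MeasurableSet (S : Set ℝ))
    (hs : s ∈ momentSeqs (S : Set ℝ)) (n : ℕ) : s ^ n ∈ momentSeqs (S : Set ℝ) := by
  induction n with
  | zero => simpa [Pi.one_def] using pow_mem_momentSeqs S.one_mem
  | succ n ih => exact pow_succ s n ▸ mul_mem_momentSeqs (S := S.toSubsemigroup) hS ih hs

theorem neg_one_pow_mul_mem_momentSeqs (hs : s ∈ momentSeqs K) :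
    (fun k => (-1) ^ k * s k) ∈ momentSeqs (-K) := by
  obtain ⟨μ, hμ, hs⟩ := hs
  have hneg (k : ℕ) (x : ℝ) : MeasurableEquiv.neg ℝ x ^ k = (-1) ^ k * x ^ k := neg_pow x k
  refine ⟨μ.map (MeasurableEquiv.neg ℝ), ⟨fun k => ?_, ?_⟩, fun k => ?_⟩
  · rw [(MeasurableEquiv.neg ℝ).measurableEmbedding.integrable_map_iff]
    simpa only [Function.comp_def, hneg] using (hμ.integrable_pow k).const_mul _
  · rw [MeasurableEquiv.map_apply]
    convert! hμ.compl_null using 2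
    ext x
    simp
  · rw [powerMoment, (MeasurableEquiv.neg ℝ).measurableEmbedding.integral_map]
    simp only [hneg, integral_const_mul, hs, powerMoment]

theorem apply_neg_one_pow_mul_of_even {F : ℝ → ℝ} (hF : F.Even) (k : ℕ) (x : ℝ) :
    F ((-1) ^ k * x) = F x := by
  rcases neg_one_pow_eq_or ℝ k with h | h
  · rw [h, one_mul]
  · rw [h, neg_one_mul, hF]

theorem mapsTo_momentSeqs_neg {F : ℝ → ℝ} (hF : F.Even) {T : Set (ℕ → ℝ)}
    (h : Set.MapsTo (entrywise F) (momentSeqs K) T) :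
    Set.MapsTo (entrywise F) (momentSeqs (-K)) T := by
  intro s hs
  have heq : entrywise F (fun k => (-1) ^ k * s k) = entrywise F s :=
    funext fun k => apply_neg_one_pow_mul_of_even hF k (s k)
  exact heq ▸ h (neg_neg K ▸ neg_one_pow_mul_mem_momentSeqs hs)

theorem rieszFunctional_nonneg (hs : s ∈ momentSeqs K) {p : ℝ[X]}
    (hp : ∀ x ∈ K, 0 ≤ p.eval x) : 0 ≤ rieszFunctional s p := by
  obtain ⟨μ, hμ, hs⟩ := hs
  have hint : rieszFunctional s p = ∫ x, p.eval x ∂μ := by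
    simp only [rieszFunctional_apply, eval_eq_sum, Polynomial.sum_def, hs, powerMoment]
    rw [integral_finsetSum _ fun k _ => (hμ.integrable_pow k).const_mul _]
    simp only [integral_const_mul]
  rw [hint]
  exact integral_nonneg_of_ae (hμ.ae_mem.mono hp)

theorem momentSeqs_nonneg (hK : K ⊆ Set.Ici 0) (hs : s ∈ momentSeqs K) (k : ℕ) : 0 ≤ s k := by
  simpa using rieszFunctional_nonneg hs (p := X ^ k) fun x hx => by simpa using pow_nonneg (hK hx) k

theorem momentSeqs_second_difference_nonneg (hs : s ∈ momentSeqs (Set.Ici 0)) (m : ℕ) :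
    0 ≤ s m - (2 : ℝ) * s (m + 1) + s (m + 2) := by
  have hpoly : (X ^ m * (1 - X) ^ 2 : ℝ[X]) = X ^ m - (2 : ℝ) • X ^ (m + 1) + X ^ (m + 2) := by
    rw [two_smul]
    ring
  have h := rieszFunctional_nonneg hs (p := X ^ m * (1 - X) ^ 2) fun x hx => by
    have : 0 ≤ x := hx
    simp only [eval_mul, eval_pow, eval_sub, eval_X, eval_one]
    positivity
  simpa [hpoly] using h

theorem momentSeqs_eq_zero (hK : K ⊆ Set.Ici 0) (hs : s ∈ momentSeqs K) {k : ℕ} (hk : s k = 0)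
    {j : ℕ} (hj : j ≠ 0) : s j = 0 := by
  obtain ⟨μ, hμ, hs⟩ := hs
  rw [hs] at hk ⊢
  have hpow : (fun x : ℝ => x ^ k) =ᵐ[μ] 0 :=
    (integral_eq_zero_iff_of_nonneg_ae (hμ.ae_mem.mono fun _ hx => pow_nonneg (hK hx) k)
      (hμ.integrable_pow k)).1 hk
  refine integral_eq_zero_of_ae (hpow.mono fun x hx => ?_)
  have hx0 : x = 0 := eq_zero_of_pow_eq_zero hx
  simp [hx0, hj]

end MomentSequences

section Transforms

open Polynomial

variable {F : ℝ → ℝ} {a : ℕ → ℝ}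

theorem nonneg_and_even_and_monotoneOn_of_mapsTo_truncMomentSeqs
    (h : Set.MapsTo (entrywise F) (truncMomentSeqs 4 {-1, 0}) (truncMomentSeqs 4 (Set.Ici 0))) :
    0 ≤ F 0 ∧ F.Even ∧ MonotoneOn F (Set.Ici 0) := by
  have htest (x y : ℝ) (hx : 0 ≤ x) (hxy : x ≤ y) :
      0 ≤ F y ∧ 0 ≤ F y - 2 * F (-x) + F x ∧ F x = F (-x) := by
    -- The moments of `x • δ₋₁ + (y - x) • δ₀` are `y, -x, x, -x, x`.
    have hmem : (fun k => x * (-1) ^ k + (y - x) * 0 ^ k) ∈ momentSeqs {-1, 0} :=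
      two_point_mem_momentSeqs hx (sub_nonneg.2 hxy)
    obtain ⟨t, ht, hst⟩ :=
      mem_truncMomentSeqs_iff.1 (h (mem_truncMomentSeqs_iff.2 ⟨_, hmem, fun _ => rfl⟩))
    have h0 : F y = t 0 := by simpa [entrywise] using hst 0
    have h1 : F (-x) = t 1 := by simpa [entrywise] using hst 1
    have h2 : F x = t 2 := by simpa [entrywise] using hst 2
    have h3 : F (-x) = t 3 := by simpa [entrywise, Odd.neg_one_pow (n := 3) (by decide)] using hst 3
    have h4 : F x = t 4 := by simpa [entrywise, Even.neg_one_pow (n := 4) (by decide)] using hst 4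
    have hdiff := momentSeqs_second_difference_nonneg ht
    refine ⟨h0 ▸ momentSeqs_nonneg subset_rfl ht 0, ?_, ?_⟩
    · rw [h0, h1, h2]
      exact hdiff 0
    · linarith [hdiff 1, hdiff 2]
  refine ⟨(htest 0 0 le_rfl le_rfl).1, fun x => ?_, fun x hx y _ hxy => ?_⟩
  · rcases le_total 0 x with hx | hx
    · exact (htest x x hx le_rfl).2.2.symm
    · simpa using (htest (-x) (-x) (neg_nonneg.2 hx) le_rfl).2.2
  · linarith [(htest x y hx hxy).2]

/-- `F` is the sum of the power series `∑ a n * |x| ^ n` with non-negative coefficients away from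
the origin, while `F 0` may be any number between `0` and the sum `a 0` of the series there. -/
structure HasEvenPowerSeriesOffZero (F : ℝ → ℝ) (a : ℕ → ℝ) : Prop where
  coeff_nonneg : ∀ n, 0 ≤ a n
  hasSum : ∀ x : ℝ, x ≠ 0 → HasSum (fun n => a n * |x| ^ n) (F x)
  zero_nonneg : 0 ≤ F 0
  zero_le : F 0 ≤ a 0

theorem tendsto_nhdsNE_zero_of_hasSum (ha : ∀ n, 0 ≤ a n)
    (hsum : ∀ x : ℝ, x ≠ 0 → HasSum (fun n => a n * |x| ^ n) (F x)) :
    Tendsto F (𝓝[≠] 0) (𝓝 (a 0)) := by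
  have hcont : Continuous fun x : ℝ => ∑' n, a n * |x| ^ n :=
    (continuous_tsum_mul_pow ha fun x hx => by
      simpa only [abs_of_pos hx] using (hsum x hx.ne').summable).comp continuous_abs
  have hzero : ∑' n, a n * |(0 : ℝ)| ^ n = a 0 := by
    rw [tsum_eq_single 0 fun n hn => by simp [hn]]
    simp
  refine ((hzero ▸ hcont.tendsto 0).mono_left nhdsWithin_le_nhds).congr' ?_
  exact eventually_mem_nhdsWithin.mono fun x hx => (hsum x hx).tsum_eq

theorem HasEvenPowerSeriesOffZero.even (h : HasEvenPowerSeriesOffZero F a) : F.Even := by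
  intro x
  rcases eq_or_ne x 0 with rfl | hx
  · rw [neg_zero]
  · exact (h.hasSum (-x) (neg_ne_zero.2 hx)).unique (by simpa only [abs_neg] using h.hasSum x hx)

theorem HasEvenPowerSeriesOffZero.apply_zero_le (h : HasEvenPowerSeriesOffZero F a) (x : ℝ) :
    F 0 ≤ F x := by
  rcases eq_or_ne x 0 with rfl | hx
  · rfl
  · have hle := le_hasSum (h.hasSum x hx) 0 fun n _ =>
      mul_nonneg (h.coeff_nonneg n) (pow_nonneg (abs_nonneg x) n)
    exact h.zero_le.trans (by simpa using hle)

theorem HasEvenPowerSeriesOffZero.mapsTo_momentSeqs (h : HasEvenPowerSeriesOffZero F a)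
    {S : Submonoid ℝ} (hS : MeasurableSet (S : Set ℝ)) (hS₀ : 0 ∈ S)
    (hS_nonneg : (S : Set ℝ) ⊆ Set.Ici 0) :
    Set.MapsTo (entrywise F) (momentSeqs (S : Set ℝ)) (momentSeqs (S : Set ℝ)) := by
  intro s hs
  by_cases hzero : ∃ k, s k = 0
  · obtain ⟨k, hk⟩ := hzero
    have hmem : (fun j => (F (s 0) - F 0) * 0 ^ j + F 0 * 1 ^ j) ∈ momentSeqs {0, 1} :=
      two_point_mem_momentSeqs (sub_nonneg.2 (h.apply_zero_le _)) h.zero_nonneg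
    have heq : entrywise F s = fun j => (F (s 0) - F 0) * 0 ^ j + F 0 * 1 ^ j := by
      funext j
      rcases eq_or_ne j 0 with rfl | hj
      · simp [entrywise]
      · simp [entrywise, hj, momentSeqs_eq_zero hS_nonneg hs hk hj]
    rw [heq]
    exact momentSeqs_mono (Set.pair_subset hS₀ S.one_mem) hmem
  · push Not at hzero
    refine hasSum_mem_momentSeqs hS_nonneg
      (fun n => smul_mem_momentSeqs (h.coeff_nonneg n) (pow_seq_mem_momentSeqs hS hs n))
      fun k => ?_
    have hsum := h.hasSum (s k) (hzero k)
    rwa [abs_of_nonneg (momentSeqs_nonneg hS_nonneg hs k)] at hsum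

theorem exists_hasEvenPowerSeriesOffZero_iff :
    (∃ a, HasEvenPowerSeriesOffZero F a) ↔
      (∃ G : ℂ → ℂ, IsAbsMonotonicEntire G ∧
          (∀ x : ℝ, 0 < x → (F x : ℂ) = G (x : ℂ)) ∧
          (∀ x : ℝ, x < 0 → (F x : ℂ) = G ((-x : ℝ) : ℂ))) ∧
        0 ≤ F 0 ∧ ∃ L : ℝ, Tendsto F (𝓝[≠] 0) (𝓝 L) ∧ F 0 ≤ L := by
  constructor
  · rintro ⟨a, h⟩
    have hpos (x : ℝ) (hx : 0 < x) : HasSum (fun n => a n * x ^ n) (F x) := by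
      simpa only [abs_of_pos hx] using h.hasSum x hx.ne'
    have hG (x : ℝ) (hx : 0 < x) : (F x : ℂ) = ∑' n, (a n : ℂ) * (x : ℂ) ^ n := by
      rw [← (hpos x hx).tsum_eq]
      push_cast
      rfl
    refine ⟨⟨fun z => ∑' n, (a n : ℂ) * z ^ n, ?_, hG, fun x hx => ?_⟩, h.zero_nonneg, a 0,
      tendsto_nhdsNE_zero_of_hasSum h.coeff_nonneg h.hasSum, h.zero_le⟩
    · exact isAbsMonotonicEntire_iff_exists_hasSum.2 ⟨a, h.coeff_nonneg, fun z =>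
        (summable_mul_pow_of_nonneg h.coeff_nonneg (fun x hx => (hpos x hx).summable) z).hasSum⟩
    · exact (congrArg _ (h.even x).symm).trans (hG (-x) (neg_pos.2 hx))
  · rintro ⟨⟨G, hG, hpos, hneg⟩, hF₀, L, hL, hF₀L⟩
    obtain ⟨a, ha, hsum⟩ := isAbsMonotonicEntire_iff_exists_hasSum.1 hG
    have hFG (x : ℝ) (hx : x ≠ 0) : (F x : ℂ) = G (|x| : ℝ) := by
      rcases hx.lt_or_gt with hx | hx
      · rw [hneg x hx, abs_of_neg hx]
      · rw [hpos x hx, abs_of_pos hx]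
    have hsumF (x : ℝ) (hx : x ≠ 0) : HasSum (fun n => a n * |x| ^ n) (F x) := by
      have h := hsum (|x| : ℝ)
      rw [← hFG x hx] at h
      exact_mod_cast h
    have hLa : L = a 0 := tendsto_nhds_unique hL (tendsto_nhdsNE_zero_of_hasSum ha hsumF)
    exact ⟨a, ha, hsumF, hF₀, hLa ▸ hF₀L⟩

theorem exists_hasEvenPowerSeriesOffZero_of_mapsTo {u : ℝ} (hu0 : 0 < u) (hu1 : u ≠ 1)
    (h : Set.MapsTo (entrywise F) (momentSeqs {-1, -u}) (momentSeqs (Set.Ici 0)))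
    (h₄ : Set.MapsTo (entrywise F) (truncMomentSeqs 4 {-1, 0}) (truncMomentSeqs 4 (Set.Ici 0))) :
    ∃ a, HasEvenPowerSeriesOffZero F a := by
  obtain ⟨hF₀, heven, hmono⟩ := nonneg_and_even_and_monotoneOn_of_mapsTo_truncMomentSeqs h₄
  have hmax : Monotone fun x => F (max x 0) := fun x y hxy =>
    hmono (le_max_right x 0) (le_max_right y 0) (max_le_max_right 0 hxy)
  have hneg : Set.MapsTo (entrywise F) (momentSeqs {1, u}) (momentSeqs (Set.Ici 0)) := by
    simpa using mapsTo_momentSeqs_neg heven h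
  obtain ⟨a, ha, hsum⟩ := exists_hasSum_of_rieszFunctional_geometric hmax hu0 hu1
    fun x b hx hb q => by
      have hmem : (fun k => x * 1 ^ k + b * u ^ k) ∈ momentSeqs {1, u} :=
        two_point_mem_momentSeqs hx hb.le
      have hpos (k : ℕ) : 0 ≤ x + b * u ^ k := by positivity
      simp only [one_pow, mul_one] at hmem
      simp only [max_eq_left (hpos _)]
      exact rieszFunctional_nonneg (hneg hmem) fun y _ => by simpa using sq_nonneg (q.eval y)
  have hsumF (x : ℝ) (hx : x ≠ 0) : HasSum (fun n => a n * |x| ^ n) (F x) := by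
    have habs : F |x| = F x := by
      rcases abs_choice x with h | h <;> rw [h]
      exact heven x
    simpa only [max_eq_left (abs_nonneg x), habs] using hsum |x| (abs_pos.2 hx)
  refine ⟨a, ha, hsumF, hF₀, ?_⟩
  have hlim := (tendsto_nhdsNE_zero_of_hasSum ha hsumF).mono_left (nhdsGT_le_nhdsNE 0)
  exact ge_of_tendsto hlim (eventually_mem_nhdsWithin.mono fun x hx =>
    hmono Set.self_mem_Ici (Set.mem_Ici_of_Ioi hx) (Set.mem_Ici_of_Ioi hx))

theorem theorem6p3_general (F : ℝ → ℝ) (u₀ : ℝ) (hu₀ : 0 < u₀) (hu₀' : u₀ ≠ 1) :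
    List.TFAE
      [ Set.MapsTo (entrywise F) (momentSeqs {-1, -u₀}) (momentSeqs (Set.Ici 0)) ∧
          Set.MapsTo (entrywise F) (truncMomentSeqs 4 {-1, 0}) (truncMomentSeqs 4 (Set.Ici 0)),
        Set.MapsTo (entrywise F) (momentSeqs (Set.Iic 0)) (momentSeqs (Set.Ici 0)),
        Set.MapsTo (entrywise F) (momentSeqs {-1, -u₀}) (momentSeqs (Set.Ici 0)) ∧
          Set.MapsTo (entrywise F)
            (truncMomentSeqs 4 {-1, 0} ∪ ⋃ u ∈ Set.Ioo (0 : ℝ) 1, truncMomentSeqs 4 {-u})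
            (truncMomentSeqs 4 (Set.Ici 0)),
        Set.MapsTo (entrywise F) (momentSeqs (Set.Icc (-1) 0)) (momentSeqs (Set.Icc 0 1)),
        (∃ G : ℂ → ℂ, IsAbsMonotonicEntire G ∧
            (∀ x : ℝ, 0 < x → (F x : ℂ) = G (x : ℂ)) ∧
            (∀ x : ℝ, x < 0 → (F x : ℂ) = G ((-x : ℝ) : ℂ))) ∧
          0 ≤ F 0 ∧ ∃ L : ℝ, Tendsto F (𝓝[≠] 0) (𝓝 L) ∧ F 0 ≤ L ] := by
  rw [← exists_hasEvenPowerSeriesOffZero_iff]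
  tfae_have 1 → 5 := fun h => exists_hasEvenPowerSeriesOffZero_of_mapsTo hu₀ hu₀' h.1 h.2
  tfae_have 5 → 2 := fun ⟨_, h⟩ => by
    have hIci : Set.MapsTo (entrywise F) (momentSeqs (Set.Ici 0)) (momentSeqs (Set.Ici 0)) :=
      h.mapsTo_momentSeqs (S := (Subsemiring.nonneg ℝ).toSubmonoid) measurableSet_Ici
        (Subsemiring.nonneg ℝ).zero_mem subset_rfl
    simpa using mapsTo_momentSeqs_neg h.even hIci
  tfae_have 2 → 3 := fun h => by
    have hrestrict {K : Set ℝ} (hK : K ⊆ Set.Iic 0) := h.mono_left (momentSeqs_mono hK)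
    refine ⟨hrestrict ?_, .union (mapsTo_truncMomentSeqs (hrestrict ?_) 4)
      (Set.mapsTo_iUnion₂.2 fun u hu => mapsTo_truncMomentSeqs (hrestrict ?_) 4)⟩
    · simp [Set.pair_subset_iff, hu₀.le]
    · simp [Set.pair_subset_iff]
    · simpa using hu.1.le
  tfae_have 3 → 1 := fun h => ⟨h.1, h.2.mono_left Set.subset_union_left⟩
  tfae_have 5 → 4 := fun ⟨_, h⟩ => by
    have hIcc : Set.MapsTo (entrywise F) (momentSeqs (Set.Icc 0 1)) (momentSeqs (Set.Icc 0 1)) :=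
      h.mapsTo_momentSeqs (S := unitInterval.submonoid) measurableSet_Icc unitInterval.zero_mem
        Set.Icc_subset_Ici_self
    simpa using mapsTo_momentSeqs_neg h.even hIcc
  tfae_have 4 → 5 := fun h => by
    have hrestrict {K : Set ℝ} (hK : K ⊆ Set.Icc (-1) 0) :=
      h.mono (momentSeqs_mono hK) (momentSeqs_mono Set.Icc_subset_Ici_self)
    refine exists_hasEvenPowerSeriesOffZero_of_mapsTo (u := 1 / 2) (by norm_num) (by norm_num)
      (hrestrict ?_) (mapsTo_truncMomentSeqs (hrestrict ?_) 4) <;> norm_num [Set.pair_subset_iff]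
  tfae_finish

end Transforms

theorem theorem6p3 (F : ℝ → ℝ) (u₀ : ℝ) (hu₀ : u₀ ∈ Set.Ioo (0 : ℝ) 1) :
    List.TFAE
      [ Set.MapsTo (entrywise F) (momentSeqs {-1, -u₀}) (momentSeqs (Set.Ici 0)) ∧
          Set.MapsTo (entrywise F)
            (truncMomentSeqs 4 {-1, 0} ∪ ⋃ u ∈ Set.Ioo (0 : ℝ) 1, truncMomentSeqs 4 {-u})
            (truncMomentSeqs 4 (Set.Ici 0)),
        Set.MapsTo (entrywise F) (momentSeqs (Set.Icc (-1) 0)) (momentSeqs (Set.Icc 0 1)),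
        (∃ G : ℂ → ℂ, IsAbsMonotonicEntire G ∧
            (∀ x : ℝ, 0 < x → (F x : ℂ) = G (x : ℂ)) ∧
            (∀ x : ℝ, x < 0 → (F x : ℂ) = G ((-x : ℝ) : ℂ))) ∧
          0 ≤ F 0 ∧ ∃ L : ℝ, Tendsto F (𝓝[≠] 0) (𝓝 L) ∧ F 0 ≤ L ] :=
  (List.tfae_cons_cons.1
    (List.tfae_cons_cons.1 (theorem6p3_general F u₀ hu₀.1 hu₀.2.ne)).2).2
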